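/- There are an infinite compact Hausdorff space $\mathcal A$ (the alphabet) and a substitution $\varrho$ on $\mathcal A$, that is, a continuous map $\varrho\colon\mathcal A\to\mathcal A^{+}=\bigsqcup_{n\geqslant 1}\mathcal A^{n}$ into the nonempty finite words over $\mathcal A$ (with the disjoint union of the product topologies), with the following properties. 1. There are a real number $\lambda>1$ and a strictly positive continuous function $\ell\colon\mathcal A\to\mathbb R$ with $\lambda\,\ell(a)=\sum_{i=1}^{n}\ell(b_i)$ for every letter $a$, where $\varrho(a)=b_1b_2\cdots b_n$ (a natural tile length function with inflation factor $\lambda$: the segment of length $\ell(a)$ assigned to $a$, inflated by $\lambda$, is cut in order into the segments assigned to the letters of $\varrho(a)$). The number $\lambda$ is uniquely determined by $\varrho$, and $\ell$ is unique up to multiplication by a positive constant, among all such pairs $(\ell,\lambda)$. 2. The inflation factor $\lambda$ is a transcendental number. 3. Let $\mathcal L(\varrho)$ be the closure, in the space $\mathcal A^{*}$ of finite words (with the disjoint union of the product topologies), of the set of all contiguous subwords of the words $\varrho^{k}(a)$, $k\geqslant 0$, $a\in\mathcal A$, where $\varrho$ is extended to words by concatenation, and let $X_\varrho\subseteq\mathcal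 A^{\mathbb Z}$ be the subshift of all bi-infinite sequences all of whose finite subwords lie in $\mathcal L(\varrho)$. Then $X_\varrho$ is non-empty, and every $x\in X_\varrho$ gives rise to a Delone set: if $\mathbb R$ is tiled by consecutive segments of lengths $\ell(x_n)$, $n\in\mathbb Z$, in this order, with the left endpoint of the segment belonging to $x_0$ at the origin, then the set of left endpoints of all the segments is uniformly discrete and relatively dense in $\mathbb R$. -/

import Mathlib

/-- A substitution on the alphabet `A`: a continuous map from `A` to the space of nonempty finite
words over `A`. Words are lists; Mathlib's topology on `List A` is the disjoint union of the
product topologies on the sets of words of a fixed length. -/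
structure Substitution (A : Type*) [TopologicalSpace A] where
  toFun : A → List A
  continuous_toFun : Continuous toFun
  ne_nil : ∀ a, toFun a ≠ []

/-- The word `x m, x (m + 1), …, x (m + n - 1)` of length `n` read off a bi-infinite sequence. -/
def biinfiniteSubword {A : Type*} (x : ℤ → A) (m : ℤ) (n : ℕ) : List A :=
  (List.range n).map fun i => x (m + (i : ℤ))

namespace Substitution

variable {A : Type*} [TopologicalSpace A]

/-- The extension of a substitution to all finite words by concatenation. -/
def onWords (ρ : Substitution A) (w : List A) : List A := w.flatMap ρ.toFun

/-- The level-`k` supertile of type `a`, i.e. the `k`-fold iterate applied to the letter `a`. -/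
def supertile (ρ : Substitution A) (k : ℕ) (a : A) : List A := (ρ.onWords)^[k] [a]

/-- The language: the closure of the set of all subwords (contiguous) of supertiles. -/
def language (ρ : Substitution A) : Set (List A) :=
  closure {u | ∃ (k : ℕ) (a : A), u <:+: ρ.supertile k a}

/-- The subshift: all bi-infinite sequences all of whose finite subwords are in the language. -/
def subshift (ρ : Substitution A) : Set (ℤ → A) :=
  {x | ∀ (m : ℤ) (n : ℕ), biinfiniteSubword x m n ∈ ρ.language}

/-- `ℓ` is a strictly positive continuous natural length function for `ρ` with inflation factor
`lam > 1`: stretching a segment of length `ℓ a` by `lam` gives a segment that can be cut, from left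
to right, into segments of lengths `ℓ b`, with `b` running through the word `ρ a`. -/
structure IsNaturalLength (ρ : Substitution A) (ℓ : A → ℝ) (lam : ℝ) : Prop where
  continuous : Continuous ℓ
  pos : ∀ a, 0 < ℓ a
  one_lt : 1 < lam
  inflate : ∀ a, lam * ℓ a = ((ρ.toFun a).map ℓ).sum

end Substitution

/-- The left endpoint of the `n`-th tile in the tiling of the line by segments of lengths `ℓ (x i)`
placed in the order given by `x`, where tile number `0` starts at the origin. -/
def leftEndpoint {A : Type*} (ℓ : A → ℝ) (x : ℤ → A) : ℤ → ℝ
  | Int.ofNat n => ∑ i ∈ Finset.range n, ℓ (x (i : ℤ))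
  | Int.negSucc n => -∑ i ∈ Finset.range (n + 1), ℓ (x (-(i : ℤ) - 1))

/-- Uniform discreteness together with relative denseness in the real line. -/
def IsDeloneSet (S : Set ℝ) : Prop := ∃ D : Delone.DeloneSet ℝ, (D : Set ℝ) = S

/-! The alphabet is the Cantor space of digit sequences, and a letter `x` is sent to `x 0 + 1`
copies of a fixed letter `w` followed by the shift of `x`. Reading a letter as a base-`lam`
expansion with digits from 1 to 4 gives a length satisfying `lam * ℓ x = (x 0 + 1) + ℓ (shift x)`,
which is the inflation rule exactly when `ℓ w = 1`. Every `lam` between 2 and 3 admits such a `w`,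
so `lam` may be taken transcendental. Digits at least 1 make `ℓ` positive and put `w` in every
image, which forces uniqueness. Compactness bounds `ℓ` away from zero and infinity, hence the Delone
property. -/

open Filter Topology

section LeftEndpoint

variable {A : Type*}

lemma leftEndpoint_add_one (ℓ : A → ℝ) (x : ℤ → A) (n : ℤ) :
    leftEndpoint ℓ x (n + 1) = leftEndpoint ℓ x n + ℓ (x n) := by
  match n with
  | Int.ofNat n => exact Finset.sum_range_succ _ _
  | Int.negSucc 0 =>
    change leftEndpoint ℓ x (Int.ofNat 0) = _
    simp [leftEndpoint]
  | Int.negSucc (n + 1) =>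
    change leftEndpoint ℓ x (Int.negSucc n) = _
    have h : (Int.negSucc (n + 1)) = -((n + 1 : ℕ) : ℤ) - 1 := by
      rw [Int.negSucc_eq]; push_cast; ring
    simp only [leftEndpoint]
    rw [Finset.sum_range_succ _ (n + 1), h]
    ring

lemma mul_le_leftEndpoint_add_sub {ℓ : A → ℝ} {c : ℝ} (hc : ∀ a, c ≤ ℓ a) (x : ℤ → A) (m : ℤ)
    (n : ℕ) : c * n ≤ leftEndpoint ℓ x (m + n) - leftEndpoint ℓ x m := by
  induction n with
  | zero => simp
  | succ n ih =>
    have h := leftEndpoint_add_one ℓ x (m + n)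
    have := hc (x (m + n))
    push_cast
    rw [← add_assoc, h]
    linarith

lemma mul_le_leftEndpoint_sub {ℓ : A → ℝ} {c : ℝ} (hc : ∀ a, c ≤ ℓ a) (x : ℤ → A) {m n : ℤ}
    (h : m ≤ n) : c * (n - m : ℝ) ≤ leftEndpoint ℓ x n - leftEndpoint ℓ x m := by
  obtain ⟨k, rfl⟩ := Int.le.dest h
  simpa using mul_le_leftEndpoint_add_sub hc x m k

/-- Tile lengths bounded away from zero and infinity give Delone sets. -/
lemma isDeloneSet_range_leftEndpoint {ℓ : A → ℝ} {c C : ℝ} (hc : 0 < c) (hcl : ∀ a, c ≤ ℓ a)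
    (hCl : ∀ a, ℓ a ≤ C) (x : ℤ → A) : IsDeloneSet (Set.range (leftEndpoint ℓ x)) := by
  have hC : 0 < C := hc.trans_le ((hcl (x 0)).trans (hCl (x 0)))
  have key : ∀ {m n : ℤ}, m < n → c / 2 < leftEndpoint ℓ x n - leftEndpoint ℓ x m := by
    intro m n h
    have h1 := mul_le_leftEndpoint_sub hcl x h.le
    have h2 : (1 : ℝ) ≤ n - m := by
      have : (m : ℝ) + 1 ≤ n := by exact_mod_cast h
      linarith
    nlinarith
  refine ⟨⟨Set.range (leftEndpoint ℓ x), (c / 2).toNNReal, by simpa using hc, ?_,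
    C.toNNReal, by simpa using hC, ?_⟩, rfl⟩
  · rintro _ ⟨m, rfl⟩ _ ⟨n, rfl⟩ hne
    have hmn : m ≠ n := fun h => hne (by rw [h])
    have : c / 2 < dist (leftEndpoint ℓ x m) (leftEndpoint ℓ x n) := by
      rcases lt_or_gt_of_ne hmn with h | h
      · rw [dist_comm]
        exact (key h).trans_le (le_abs_self _)
      · exact (key h).trans_le (le_abs_self _)
    rw [edist_dist]
    exact (ENNReal.ofReal_lt_ofReal_iff (by linarith)).2 this
  · intro t _
    -- The tile containing `t`; it exists because endpoints grow at least linearly, with slope `c`.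
    obtain ⟨n, hn, hmax⟩ : ∃ n : ℤ, leftEndpoint ℓ x n ≤ t ∧
        ∀ z, leftEndpoint ℓ x z ≤ t → z ≤ n := by
      apply Int.exists_greatest_of_bdd
      · refine ⟨max 0 ⌈t / c⌉, fun z hz => ?_⟩
        rcases le_total z 0 with h | h
        · exact h.trans (le_max_left _ _)
        · have h1 := mul_le_leftEndpoint_sub hcl x h
          have h0 : leftEndpoint ℓ x 0 = 0 := Finset.sum_range_zero _
          refine le_trans ?_ (le_max_right _ _)
          have h2 : (z : ℝ) ≤ t / c := by
            rw [le_div_iff₀ hc]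
            simp only [h0, Int.cast_zero] at h1
            linarith
          exact_mod_cast h2.trans (Int.le_ceil _)
      · refine ⟨min 0 ⌊t / c⌋, ?_⟩
        have h1 := mul_le_leftEndpoint_sub hcl x (min_le_left 0 ⌊t / c⌋)
        have h0 : leftEndpoint ℓ x 0 = 0 := Finset.sum_range_zero _
        have h2 : ((min 0 ⌊t / c⌋ : ℤ) : ℝ) ≤ t / c :=
          le_trans (by exact_mod_cast min_le_right _ _) (Int.floor_le _)
        rw [le_div_iff₀ hc] at h2
        simp only [h0, Int.cast_zero] at h1
        linarith
    refine ⟨leftEndpoint ℓ x n, ⟨n, rfl⟩, ?_⟩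
    have h1 : t < leftEndpoint ℓ x (n + 1) := by
      by_contra! h
      have := hmax _ h
      omega
    rw [leftEndpoint_add_one] at h1
    have h2 := hCl (x n)
    change edist t (leftEndpoint ℓ x n) ≤ ENNReal.ofReal C
    rw [edist_dist]
    apply ENNReal.ofReal_le_ofReal
    rw [Real.dist_eq, abs_of_nonneg (by linarith)]
    linarith

end LeftEndpoint

/-- In the definition the index elaborates as an integer, so the range is coerced through the list
monad; this restores a natural index. -/
lemma biinfiniteSubword_eq_map {A : Type*} (x : ℤ → A) (m : ℤ) (n : ℕ) :
    biinfiniteSubword x m n = (List.range n).map fun i : ℕ => x (m + (i : ℤ)) := by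
  change List.map _ (List.flatMap (fun i : ℕ => [(i : ℤ)]) (List.range n)) = _
  rw [← List.map_eq_flatMap, List.map_map]
  rfl

lemma continuous_biinfiniteSubword {A : Type*} [TopologicalSpace A] (m : ℤ) (n : ℕ) :
    Continuous fun x : ℤ → A => biinfiniteSubword x m n := by
  simp only [biinfiniteSubword_eq_map]
  induction List.range n with
  | nil => exact continuous_const
  | cons i l ih => exact List.continuous_cons.comp ((continuous_apply (m + (i : ℤ))).prodMk ih)

/-! ### Subshift and uniqueness of natural lengths -/

namespace Substitution

variable {A : Type*} [TopologicalSpace A] {ρ : Substitution A}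

lemma supertile_succ (ρ : Substitution A) (k : ℕ) (a : A) :
    ρ.supertile (k + 1) a = ρ.onWords (ρ.supertile k a) :=
  Function.iterate_succ_apply' _ _ _

lemma two_mul_length_le_length_onWords (h : ∀ a, 2 ≤ (ρ.toFun a).length) (u : List A) :
    2 * u.length ≤ (ρ.onWords u).length := by
  induction u with
  | nil => simp
  | cons a u ih =>
    have := h a
    simp only [onWords, List.flatMap_cons, List.length_append, List.length_cons] at ih ⊢
    omega

lemma lt_length_supertile (h : ∀ a, 2 ≤ (ρ.toFun a).length) (k : ℕ) (a : A) :
    k < (ρ.supertile k a).length := by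
  induction k with
  | zero => simp [supertile]
  | succ k ih =>
    have := two_mul_length_le_length_onWords h (ρ.supertile k a)
    rw [supertile_succ]
    omega

/-- The subshift of a substitution of minimal word length at least two is non-empty: centre the
supertiles of even level at the origin and take a cluster point. -/
lemma subshift_nonempty [CompactSpace A] (w : A) (h : ∀ a, 2 ≤ (ρ.toFun a).length) :
    ρ.subshift.Nonempty := by
  -- The supertile has more than `2 * k` letters, so the default `w` never enters a fixed window
  -- once `k` is large.
  let y : ℕ → ℤ → A := fun k i => (ρ.supertile (2 * k) w).getD (i + k).toNat w
  obtain ⟨x, -, hx⟩ := isCompact_univ.ultrafilter_le_nhds ((hyperfilter ℕ).map y) (by simp)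
  refine ⟨x, fun m n => ?_⟩
  have hlim : Tendsto (fun k => biinfiniteSubword (y k) m n) (hyperfilter ℕ)
      (𝓝 (biinfiniteSubword x m n)) :=
    ((continuous_biinfiniteSubword m n).tendsto x).comp hx
  refine mem_closure_of_tendsto hlim ?_
  have hev : ∀ᶠ k in (hyperfilter ℕ : Filter ℕ), m.natAbs + n ≤ k :=
    (Nat.hyperfilter_le_atTop) (eventually_ge_atTop _)
  filter_upwards [hev] with k hk
  refine ⟨2 * k, w, ?_⟩
  have hlen := lt_length_supertile h (2 * k) w
  have heq : biinfiniteSubword (y k) m n =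
      ((ρ.supertile (2 * k) w).drop (m + k).toNat).take n := by
    apply List.ext_getElem
    · simp only [biinfiniteSubword_eq_map, List.length_map, List.length_range, List.length_take,
        List.length_drop]
      omega
    · intro i h1 h2
      simp only [biinfiniteSubword_eq_map, List.length_map, List.length_range] at h1
      have h3 : (m + (i : ℤ) + k).toNat = (m + k).toNat + i := by omega
      have h4 : (m + k).toNat + i < (ρ.supertile (2 * k) w).length := by omega
      simp [biinfiniteSubword_eq_map, y, h3, h4]
  rw [heq]
  exact (List.take_prefix _ _).isInfix.trans (List.drop_suffix _ _).isInfix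

section Uniqueness

variable {ℓ ℓ' : A → ℝ} {lam lam' : ℝ}

/-- `c` is the maximum of the continuous ratio `ℓ' / ℓ`, attained at `a`. -/
lemma IsNaturalLength.exists_tight_bound [CompactSpace A] [Nonempty A]
    (h : ρ.IsNaturalLength ℓ lam) (h' : ρ.IsNaturalLength ℓ' lam') :
    ∃ c a, ℓ' a = c * ℓ a ∧ ∀ b, ℓ' b ≤ c * ℓ b := by
  obtain ⟨a, -, ha⟩ := isCompact_univ.exists_isMaxOn Set.univ_nonempty
    (h'.continuous.div h.continuous fun a => (h.pos a).ne').continuousOn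
  refine ⟨ℓ' a / ℓ a, a, (div_mul_cancel₀ _ (h.pos a).ne').symm, fun b => ?_⟩
  rw [← div_le_iff₀ (h.pos b)]
  exact ha (Set.mem_univ b)

lemma IsNaturalLength.inflation_le [CompactSpace A] [Nonempty A]
    (h : ρ.IsNaturalLength ℓ lam) (h' : ρ.IsNaturalLength ℓ' lam') : lam' ≤ lam := by
  obtain ⟨c, a, ha, hb⟩ := h.exists_tight_bound h'
  have h1 : ((ρ.toFun a).map ℓ').sum ≤ ((ρ.toFun a).map fun b => c * ℓ b).sum :=
    List.sum_le_sum fun b _ => hb b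
  rw [List.sum_map_mul_left, ← h.inflate, ← h'.inflate, mul_left_comm, ← ha] at h1
  exact le_of_mul_le_mul_right h1 (h'.pos a)

/-- Where `ℓ' / ℓ` is maximal, the inflation rule forces equality at every letter of the image, so
`w` is also a maximiser. -/
lemma IsNaturalLength.le_ratio_mul [CompactSpace A] {w : A} (hw : ∀ a, w ∈ ρ.toFun a)
    (h : ρ.IsNaturalLength ℓ lam) (h' : ρ.IsNaturalLength ℓ' lam) (b : A) :
    ℓ' b ≤ ℓ' w / ℓ w * ℓ b := by
  have : Nonempty A := ⟨w⟩
  obtain ⟨c, a, ha, hb⟩ := h.exists_tight_bound h'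
  have hcw : ℓ' w = c * ℓ w := by
    refine (hb w).eq_of_not_lt fun hlt => ?_
    have h1 : ((ρ.toFun a).map ℓ').sum < ((ρ.toFun a).map fun b => c * ℓ b).sum :=
      List.sum_lt_sum _ _ (fun b _ => hb b) ⟨w, hw a, hlt⟩
    rw [List.sum_map_mul_left, ← h.inflate, ← h'.inflate, mul_left_comm, ← ha] at h1
    exact h1.false
  rw [hcw, mul_div_cancel_right₀ _ (h.pos w).ne']
  exact hb b

/-- If a letter occurs in the image of every letter, then the inflation factor is unique, and the
natural length function is unique up to scaling. -/
lemma IsNaturalLength.unique [CompactSpace A] {w : A} (hw : ∀ a, w ∈ ρ.toFun a)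
    (h : ρ.IsNaturalLength ℓ lam) (h' : ρ.IsNaturalLength ℓ' lam') :
    lam' = lam ∧ ∃ c : ℝ, 0 < c ∧ ∀ a, ℓ' a = c * ℓ a := by
  have : Nonempty A := ⟨w⟩
  obtain rfl : lam' = lam := (h.inflation_le h').antisymm (h'.inflation_le h)
  have hp := h.pos w
  have hp' := h'.pos w
  refine ⟨rfl, ℓ' w / ℓ w, by positivity, fun a => (h.le_ratio_mul hw h' a).antisymm ?_⟩
  have h1 := h'.le_ratio_mul hw h a
  rw [div_mul_eq_mul_div, le_div_iff₀ hp'] at h1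
  rw [div_mul_eq_mul_div, div_le_iff₀ hp]
  linarith

end Uniqueness

lemma IsNaturalLength.isDeloneSet_range [CompactSpace A] {ℓ : A → ℝ} {lam : ℝ}
    (h : ρ.IsNaturalLength ℓ lam) (x : ℤ → A) : IsDeloneSet (Set.range (leftEndpoint ℓ x)) := by
  have : Nonempty A := ⟨x 0⟩
  obtain ⟨a, -, ha⟩ := isCompact_univ.exists_isMinOn Set.univ_nonempty h.continuous.continuousOn
  obtain ⟨b, -, hb⟩ := isCompact_univ.exists_isMaxOn Set.univ_nonempty h.continuous.continuousOn
  exact isDeloneSet_range_leftEndpoint (h.pos a) (fun c => ha (Set.mem_univ c))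
    (fun c => hb (Set.mem_univ c)) x

end Substitution

/-! ### The digit substitution and its length function -/

lemma continuous_replicate_append_singleton {A : Type*} [TopologicalSpace A] (w : A) (n : ℕ) :
    Continuous fun y : A => List.replicate n w ++ [y] := by
  induction n with
  | zero => exact List.continuous_cons.comp (continuous_id.prodMk continuous_const)
  | succ n ih => exact List.continuous_cons.comp (continuous_const.prodMk ih)

/-- The substitution on digit sequences that sends `x` to `x 0 + 1` copies of the sequence `w`,
followed by the shift of `x`. -/
def digitSubstitution (w : ℕ → Fin 4) : Substitution (ℕ → Fin 4) where
  toFun x := List.replicate (x 0 + 1 : ℕ) w ++ [fun k => x (k + 1)]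
  continuous_toFun := by
    have h : Continuous fun p : Fin 4 × (ℕ → Fin 4) =>
        List.replicate (p.1 + 1 : ℕ) w ++ [p.2] :=
      -- The first digit is discrete; fixing it fixes the word length.
      continuous_prod_of_discrete_left.2 fun i => continuous_replicate_append_singleton w (i + 1)
    have hg : Continuous fun x : ℕ → Fin 4 => (x 0, fun k => x (k + 1)) := by fun_prop
    exact h.comp hg
  ne_nil := by simp

/-- The number with expansion `x 0 + 1, x 1 + 1, …` after the radix point in base `lam`. -/
noncomputable def digitValue (lam : ℝ) (x : ℕ → Fin 4) : ℝ :=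
  ∑' k, ((x k : ℕ) + 1 : ℝ) * lam⁻¹ ^ (k + 1)

section DigitValue

variable {lam : ℝ}

lemma digit_term_le (h : 1 < lam) (x : ℕ → Fin 4) (k : ℕ) :
    ‖((x k : ℕ) + 1 : ℝ) * lam⁻¹ ^ (k + 1)‖ ≤ 4 * lam⁻¹ ^ (k + 1) := by
  have h0 : 0 < lam := by linarith
  rw [Real.norm_of_nonneg (by positivity)]
  have h1 : ((x k : ℕ) + 1 : ℝ) ≤ 4 := by exact_mod_cast (x k).isLt
  gcongr

lemma summable_digit_bound (h : 1 < lam) : Summable fun k : ℕ => 4 * lam⁻¹ ^ (k + 1) := by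
  have h0 : 0 < lam := by linarith
  exact ((summable_nat_add_iff 1).2
    (summable_geometric_of_lt_one (by positivity) (inv_lt_one_of_one_lt₀ h))).mul_left 4

lemma summable_digit_term (h : 1 < lam) (x : ℕ → Fin 4) :
    Summable fun k => ((x k : ℕ) + 1 : ℝ) * lam⁻¹ ^ (k + 1) :=
  (summable_digit_bound h).of_norm_bounded (digit_term_le h x)

lemma continuous_digitValue (h : 1 < lam) : Continuous (digitValue lam) := by
  refine continuous_tsum (fun k => ?_) (summable_digit_bound h) fun k x => digit_term_le h x k
  have h1 : Continuous fun i : Fin 4 => ((i : ℕ) + 1 : ℝ) := continuous_of_discreteTopology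
  exact (h1.comp (continuous_apply k)).mul continuous_const

lemma digitValue_pos (h : 1 < lam) (x : ℕ → Fin 4) : 0 < digitValue lam x := by
  have h0 : 0 < lam := by linarith
  exact (summable_digit_term h x).tsum_pos (fun k => by positivity) 0 (by positivity)

lemma mul_digitValue (h : 1 < lam) (x : ℕ → Fin 4) :
    lam * digitValue lam x = ((x 0 : ℕ) + 1) + digitValue lam fun k => x (k + 1) := by
  have h0 : lam ≠ 0 := by linarith
  unfold digitValue
  rw [(summable_digit_term h x).tsum_eq_zero_add, mul_add, ← tsum_mul_left]
  congr 1
  · rw [zero_add, pow_one]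
    field_simp
  · congr 1
    ext k
    rw [pow_succ]
    field_simp

lemma isNaturalLength_digitValue (h : 1 < lam) {w : ℕ → Fin 4} (hw : digitValue lam w = 1) :
    (digitSubstitution w).IsNaturalLength (digitValue lam) lam where
  continuous := continuous_digitValue h
  pos := digitValue_pos h
  one_lt := h
  inflate x := by simp [mul_digitValue h, digitSubstitution, hw]

/-- The remainders of the greedy expansion of `1` in base `lam` with digits at least `1`. -/
noncomputable def greedyRemainder (lam : ℝ) : ℕ → ℝ
  | 0 => 1
  | k + 1 => lam * greedyRemainder lam k - (⌊lam * greedyRemainder lam k⌋ - 1 : ℤ)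

lemma greedyRemainder_mem (lam : ℝ) (k : ℕ) : greedyRemainder lam k ∈ Set.Ico (1 : ℝ) 2 := by
  cases k with
  | zero => norm_num [greedyRemainder]
  | succ k =>
    have h1 := Int.floor_le (lam * greedyRemainder lam k)
    have h2 := Int.lt_floor_add_one (lam * greedyRemainder lam k)
    constructor <;> simp only [greedyRemainder] <;> push_cast <;> linarith

lemma exists_digitValue_eq_one (h2 : 2 < lam) (h3 : lam < 3) : ∃ w, digitValue lam w = 1 := by
  have h0 : 0 < lam := by linarith
  have h1 : 1 < lam := by linarith
  have hdigit : ∀ k, ∃ d : Fin 4,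
      greedyRemainder lam (k + 1) = lam * greedyRemainder lam k - ((d : ℕ) + 1) := by
    intro k
    obtain ⟨hr1, hr2⟩ := greedyRemainder_mem lam k
    -- The floor lies in 2, …, 5, so the greedy digit, one less, lies in 1, …, 4; this is why `Fin
    -- 4` suffices.
    have hlo : 2 ≤ ⌊lam * greedyRemainder lam k⌋ := Int.le_floor.2 (by push_cast; nlinarith)
    have hhi : ⌊lam * greedyRemainder lam k⌋ < 6 := Int.floor_lt.2 (by push_cast; nlinarith)
    obtain ⟨d, hd⟩ := Int.le.dest hlo
    refine ⟨⟨d, by omega⟩, ?_⟩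
    simp only [greedyRemainder, ← hd]
    push_cast
    ring
  choose w hw using hdigit
  refine ⟨w, ?_⟩
  have hpartial : ∀ n, ∑ k ∈ Finset.range n, ((w k : ℕ) + 1 : ℝ) * lam⁻¹ ^ (k + 1) =
      1 - greedyRemainder lam n * lam⁻¹ ^ n := by
    intro n
    induction n with
    | zero => simp [greedyRemainder]
    | succ n ih =>
      rw [Finset.sum_range_succ, ih, hw, pow_succ]
      field_simp
      ring
  have hzero : Tendsto (fun n => greedyRemainder lam n * lam⁻¹ ^ n) atTop (𝓝 0) := by
    have hpow : Tendsto (fun n : ℕ => 2 * lam⁻¹ ^ n) atTop (𝓝 0) := by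
      simpa using (tendsto_pow_atTop_nhds_zero_of_lt_one (by positivity)
        (inv_lt_one_of_one_lt₀ h1)).const_mul 2
    refine squeeze_zero (fun n => ?_) (fun n => ?_) hpow
    · have := (greedyRemainder_mem lam n).1
      positivity
    · have := (greedyRemainder_mem lam n).2.le
      gcongr
  have hlim := (summable_digit_term h1 w).hasSum.tendsto_sum_nat
  simp only [hpartial] at hlim
  exact tendsto_nhds_unique hlim (by simpa using hzero.const_sub 1)

end DigitValue

lemma exists_transcendental_mem_Ioo {a b : ℝ} (h : a < b) :
    ∃ x ∈ Set.Ioo a b, Transcendental ℚ x := by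
  obtain ⟨x, hx, hx'⟩ := ((Algebraic.countable ℚ ℝ).dense_compl ℝ).exists_between h
  exact ⟨x, hx', hx⟩

theorem corollary1p2 :
    ∃ (A : Type) (_ : TopologicalSpace A) (_ : CompactSpace A) (_ : T2Space A) (_ : Infinite A)
      (ρ : Substitution A) (ℓ : A → ℝ) (lam : ℝ),
      ρ.IsNaturalLength ℓ lam ∧
      (∀ (ℓ' : A → ℝ) (lam' : ℝ), ρ.IsNaturalLength ℓ' lam' →
        lam' = lam ∧ ∃ c : ℝ, 0 < c ∧ ∀ a, ℓ' a = c * ℓ a) ∧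
      Transcendental ℚ lam ∧
      ρ.subshift.Nonempty ∧
      ∀ x ∈ ρ.subshift, IsDeloneSet (Set.range (leftEndpoint ℓ x)) := by
  obtain ⟨lam, ⟨h2, h3⟩, htr⟩ := exists_transcendental_mem_Ioo (show (2 : ℝ) < 3 by norm_num)
  obtain ⟨w, hw⟩ := exists_digitValue_eq_one h2 h3
  have h := isNaturalLength_digitValue (by linarith) hw
  refine ⟨ℕ → Fin 4, inferInstance, inferInstance, inferInstance, inferInstance,
    digitSubstitution w, digitValue lam, lam, h, fun ℓ' lam' h' => ?_, htr, ?_,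
    fun x _ => h.isDeloneSet_range x⟩
  · exact h.unique (w := w) (by simp [digitSubstitution]) h'
  · exact Substitution.subshift_nonempty w (by simp [digitSubstitution])
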